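/- **Definitions.** An even rational parameter is a fraction $p/q\in(0,1)$ in lowest terms with $pq$ even. Put $\omega=p+q$, $P=2p/\omega$, $Q=2q/\omega$, and let $[t]_2\in[-1,1)$ be the representative of $t$ modulo $2\mathbb Z$. *Plaid tiling.* Let $\mathcal H$ (resp. $\mathcal V$) be the horizontal (resp. vertical) lines with integer $y$- (resp. $x$-) coordinate, and $\mathcal P$ (resp. $\mathcal Q$) the lines of slope $-P$ (resp. $-Q$) with integer $y$-intercept. Let $$F_H=[2Py]_2,\quad F_V=[2Px]_2,\quad F_P=[Py+P^2x+1]_2,\quad F_Q=[Py+PQx+1]_2 .$$ A point $z$ on a line of family $A\in\{H,V\}$ is a light point of that line if it also lies on a line of some family $B\in\{P,Q\}$ with $|F_B(z)|<|F_A(z)|$ and $F_A(z)F_B(z)>0$. A closed edge of a unit square with integer vertices is good if it contains exactly one light point of the $\mathcal H$ or $\mathcal V$ line on which it lies, where a light point that is the midpoint of a horizontal edge is counted twice. In each unit square, join the center by straight segments to the midpoints of the good edges of that square. The plaid tiling $\Pi=\Pi_{p/q}\subset\mathbb R^2$ is the union of all these segments. *Tune, $\kappa$, even predecessor.* The tune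 $\tau$ of $p/q$ is the unique integer in $(0,\omega/2)$ with $2p\tau\equiv\pm1 \pmod\omega$, and $\kappa\ge 0$ is the unique integer with $$\frac{\kappa}{2\kappa+1}\le\frac{\tau}{\omega}<\frac{\kappa+1}{2(\kappa+1)+1}.$$ An even rational parameter $p'/q'$ is the even predecessor of $p/q$ if $|p'q-pq'|=1$ and $\omega'=p'+q'<\omega$. Let $\tau'$ be the tune of $p'/q'$. *Rectangles.* Let $W'=\min(\tau',\omega'-2\tau')$ and $R_{p'/q'}=[0,W']\times[0,\omega']$. Define $\Sigma'\subset R_{p'/q'}$ as follows: if $2\omega'>\omega$ (weak case), $\Sigma'=[0,W']\times[0,\omega'-W']$; if $2\omega'<\omega$ (strong case), $\Sigma'=R_{p'/q'}$. **Lemma (Weak and Strong Copying).** Let $p/q$ be an even rational parameter with $\kappa=0$ and let $p'/q'$ be its even predecessor. Then $$\Sigma'\cap\Pi_{p'/q'}=\Sigma'\cap\Pi_{p/q}.$$ -/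

import Mathlib

noncomputable section

namespace Plaid

/-! ### Even rational parameters -/

/-- The fraction `p/q`, written in lowest terms, is an even rational parameter:
it lies in `(0,1)` and `p * q` is even. -/
def IsEvenParameter (p q : ℕ) : Prop :=
  0 < p ∧ p < q ∧ p.Coprime q ∧ Even (p * q)

/-- The number `ω = p + q`. -/
def omega (p q : ℕ) : ℕ := p + q

/-- The number `P = 2p/ω`. -/
def slopeP (p q : ℕ) : ℝ := 2 * (p : ℝ) / (omega p q : ℝ)

/-- The number `Q = 2q/ω`. -/
def slopeQ (p q : ℕ) : ℝ := 2 * (q : ℝ) / (omega p q : ℝ)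

/-- The representative `[t]_2` of `t` modulo `2ℤ` that lies in `[-1,1)`. -/
def rep2 (t : ℝ) : ℝ := toIcoMod (two_pos : (0 : ℝ) < 2) (-1) t

/-! ### The four families of lines and their adapted functions -/

/-- The two families of grid lines: horizontal and vertical. -/
inductive Grid
  | H
  | V

/-- The two families of slanting lines. -/
inductive Slant
  | P
  | Q

/-- The point `z` lies on a horizontal line with integer `y`-coordinate (family `H`),
or on a vertical line with integer `x`-coordinate (family `V`). -/
def OnGrid : Grid → ℝ × ℝ → Prop
  | Grid.H, z => ∃ n : ℤ, z.2 = n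
  | Grid.V, z => ∃ n : ℤ, z.1 = n

/-- The point `z` lies on a line with integer `y`-intercept and slope `-P` (family `P`)
or `-Q` (family `Q`). -/
def OnSlant (p q : ℕ) : Slant → ℝ × ℝ → Prop
  | Slant.P, z => ∃ b : ℤ, z.2 = -slopeP p q * z.1 + b
  | Slant.Q, z => ∃ b : ℤ, z.2 = -slopeQ p q * z.1 + b

/-- The capacity functions `F_H = [2Py]_2` and `F_V = [2Px]_2`. -/
def capacityFn (p q : ℕ) : Grid → ℝ × ℝ → ℝ
  | Grid.H, z => rep2 (2 * slopeP p q * z.2)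
  | Grid.V, z => rep2 (2 * slopeP p q * z.1)

/-- The mass functions `F_P = [Py + P²x + 1]_2` and `F_Q = [Py + PQx + 1]_2`. -/
def massFn (p q : ℕ) : Slant → ℝ × ℝ → ℝ
  | Slant.P, z => rep2 (slopeP p q * z.2 + slopeP p q ^ 2 * z.1 + 1)
  | Slant.Q, z => rep2 (slopeP p q * z.2 + slopeP p q * slopeQ p q * z.1 + 1)

/-- The point `z` is a light intersection point on a grid line of family `A`: it is the
intersection of an `A` line with some slanting line (of family `B`), and
`|F_B(z)| < |F_A(z)|` and `F_A(z) F_B(z) > 0`. -/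
def IsLight (p q : ℕ) (A : Grid) (z : ℝ × ℝ) : Prop :=
  OnGrid A z ∧ ∃ B : Slant, OnSlant p q B z ∧
    |massFn p q B z| < |capacityFn p q A z| ∧
    0 < capacityFn p q A z * massFn p q B z

/-! ### Unit segments, unit squares and the plaid polygons -/

/-- The closed unit segment on an `A` line whose left (respectively bottom) endpoint
is `(i,j)`. -/
def unitSegment : Grid → ℤ → ℤ → Set (ℝ × ℝ)
  | Grid.H, i, j => Set.Icc (i : ℝ) (i + 1) ×ˢ {(j : ℝ)}
  | Grid.V, i, j => {(i : ℝ)} ×ˢ Set.Icc (j : ℝ) (j + 1)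

/-- The midpoint of a unit segment. -/
def segmentMid : Grid → ℤ → ℤ → ℝ × ℝ
  | Grid.H, i, j => ((i : ℝ) + 1 / 2, (j : ℝ))
  | Grid.V, i, j => ((i : ℝ), (j : ℝ) + 1 / 2)

/-- The light points of a unit segment (those on the `A` line that contains the segment;
a light point at an endpoint that only belongs to the perpendicular grid line through
this endpoint does not count). -/
def lightPoints (p q : ℕ) (A : Grid) (i j : ℤ) : Set (ℝ × ℝ) :=
  {z | z ∈ unitSegment A i j ∧ IsLight p q A z}

/-- The number of light points of a unit segment, where a light point which is the midpoint
of a horizontal unit segment is counted twice. -/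
def lightCount (p q : ℕ) : Grid → ℤ → ℤ → ℕ∞
  | Grid.H, i, j => (lightPoints p q Grid.H i j).encard +
      (lightPoints p q Grid.H i j ∩ {segmentMid Grid.H i j}).encard
  | Grid.V, i, j => (lightPoints p q Grid.V i j).encard

/-- A unit segment is good if it contains exactly one light point. -/
def IsGood (p q : ℕ) (A : Grid) (i j : ℤ) : Prop := lightCount p q A i j = 1

/-- The segment with lower left endpoint `(k,l)` in direction `A` is one of the four edges of
the unit square `[i,i+1] × [j,j+1]`. -/
def IsEdgeOf (A : Grid) (k l i j : ℤ) : Prop :=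
  match A with
  | Grid.H => k = i ∧ (l = j ∨ l = j + 1)
  | Grid.V => (k = i ∨ k = i + 1) ∧ l = j

/-- The center of the unit square `[i,i+1] × [j,j+1]`. -/
def squareCenter (i j : ℤ) : ℝ × ℝ := ((i : ℝ) + 1 / 2, (j : ℝ) + 1 / 2)

/-- The plaid tile drawn in the unit square `[i,i+1] × [j,j+1]`: the center of the square is
joined by straight segments to the midpoints of the good edges of the square. -/
def tile (p q : ℕ) (i j : ℤ) : Set (ℝ × ℝ) :=
  {z | ∃ (A : Grid) (k l : ℤ), IsEdgeOf A k l i j ∧ IsGood p q A k l ∧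
    z ∈ segment ℝ (squareCenter i j) (segmentMid A k l)}

/-- The plaid tiling `Π` of the parameter `p/q`: the union of all plaid polygons, that is,
of what is drawn in all the unit squares. -/
def plaid (p q : ℕ) : Set (ℝ × ℝ) := ⋃ (i : ℤ) (j : ℤ), tile p q i j

/-! ### Tune, the number `κ`, and even predecessors -/

/-- The defining property of the tune: an integer `t` in `(0, ω/2)` with
`2pt ≡ ±1` modulo `ω`. -/
def IsTune (p q t : ℕ) : Prop :=
  0 < t ∧ 2 * t < omega p q ∧
    ((2 * p * t : ℤ) ≡ 1 [ZMOD (omega p q : ℤ)] ∨ (2 * p * t : ℤ) ≡ -1 [ZMOD (omega p q : ℤ)])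

/-- The tune `τ` of the parameter `p/q`. -/
def tune (p q : ℕ) : ℕ := sInf {t | IsTune p q t}

/-- The defining property of `κ`: `n/(2n+1) ≤ τ/ω < (n+1)/(2(n+1)+1)`. -/
def IsKappa (p q n : ℕ) : Prop :=
  (n : ℝ) / (2 * n + 1) ≤ (tune p q : ℝ) / (omega p q : ℝ) ∧
    (tune p q : ℝ) / (omega p q : ℝ) < ((n : ℝ) + 1) / (2 * ((n : ℝ) + 1) + 1)

/-- The number `κ` of the parameter `p/q`. -/
def kappa (p q : ℕ) : ℕ := sInf {n | IsKappa p q n}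

/-- `p'/q'` is the even predecessor of `p/q`: both are even rational parameters, they are
Farey related, and `ω' < ω`. -/
def IsEvenPredecessor (p' q' p q : ℕ) : Prop :=
  IsEvenParameter p' q' ∧ IsEvenParameter p q ∧
    |(p' : ℤ) * q - p * q'| = 1 ∧ omega p' q' < omega p q

/-! ### The rectangles -/

/-- The number `min(τ, ω - 2τ)`, the distance from the left edge of the first block
`[0,ω]²` to the closest vertical line of (nonzero) capacity at most `4`. -/
def width (p q : ℕ) : ℝ := min (tune p q : ℝ) ((omega p q : ℝ) - 2 * (tune p q : ℝ))

/-- The rectangle `R_{p/q}`, bounded by `x = 0`, `x = min(τ, ω - 2τ)`, `y = 0`, `y = ω`. -/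
def rectangle (p q : ℕ) : Set (ℝ × ℝ) :=
  Set.Icc 0 (width p q) ×ˢ Set.Icc 0 (omega p q : ℝ)

/-- The subrectangle `Σ'` of `R_{p'/q'}`. In the weak case `2ω' > ω` it is the part of
`R_{p'/q'}` below the line `y = ω' - min(τ', ω' - 2τ')`; in the strong case `2ω' < ω` it is
all of `R_{p'/q'}`. -/
def copyRectangle (p' q' p q : ℕ) : Set (ℝ × ℝ) :=
  if omega p q < 2 * omega p' q' then
    {z | z ∈ rectangle p' q' ∧ z.2 ≤ (omega p' q' : ℝ) - width p' q'}
  else rectangle p' q'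

/-! ### The tune and `κ` are well defined -/

theorem coprime_two_mul_omega {p q : ℕ} (h : IsEvenParameter p q) :
    (2 * p).Coprime (omega p q) := by
  obtain ⟨_, _, hc, he⟩ := h
  have h2 : Odd (omega p q) := by
    unfold omega
    by_contra hn
    have hn' : Even (p + q) := by simpa using hn
    have hpq : Even p ∧ Even q := by
      rw [Nat.even_add] at hn'
      rcases Nat.even_mul.1 he with h | h
      · exact ⟨h, hn'.1 h⟩
      · exact ⟨hn'.2 h, h⟩
    have := Nat.dvd_gcd hpq.1.two_dvd hpq.2.two_dvd
    rw [hc] at this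
    omega
  refine Nat.Coprime.mul_left ?_ ?_
  · exact (Nat.coprime_two_left).2 h2
  · unfold omega
    simpa using hc

theorem existsUnique_tune {p q : ℕ} (h : IsEvenParameter p q) : ∃! t, IsTune p q t := by
  have hc := coprime_two_mul_omega h
  have hw : 3 ≤ omega p q := by
    obtain ⟨h0, h1, _⟩ := h
    unfold omega
    omega
  have hodd : ¬ 2 ∣ omega p q := by
    intro hd
    have := Nat.dvd_gcd (Dvd.intro p rfl : 2 ∣ 2 * p) hd
    rw [hc] at this
    omega
  have hci : IsCoprime ((2 * p : ℕ) : ℤ) (omega p q : ℤ) := Nat.isCoprime_iff_coprime.2 hc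
  have hspec : ∀ t, IsTune p q t ↔ 0 < t ∧ 2 * t < omega p q ∧
      ((omega p q : ℤ) ∣ 1 - 2 * p * t ∨ (omega p q : ℤ) ∣ -1 - 2 * p * t) := by
    intro t
    simp only [IsTune, Int.modEq_iff_dvd]
  simp only [hspec]
  generalize omega p q = w at *
  push_cast at hci
  generalize (2 * p : ℤ) = c at *
  obtain ⟨a, b, hab⟩ := hci
  have hw0 : (0 : ℤ) < w := by omega
  have hdiv := Int.emod_add_mul_ediv a w
  have hr0 := Int.emod_nonneg a hw0.ne'
  have hr1 := Int.emod_lt_of_pos a hw0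
  generalize a % (w : ℤ) = r at *
  generalize a / (w : ℤ) = k at *
  have hcr : (w : ℤ) ∣ 1 - c * r := ⟨b + c * k, by rw [← hab, ← hdiv]; ring⟩
  lift r to ℕ using hr0
  have hrne : r ≠ 0 := by
    rintro rfl
    have := Int.le_of_dvd one_pos (by simpa using hcr)
    omega
  apply existsUnique_of_exists_of_unique
  · by_cases hlt : 2 * r < w
    · exact ⟨r, by omega, hlt, Or.inl hcr⟩
    · refine ⟨w - r, by omega, by omega, Or.inr ?_⟩
      obtain ⟨m, hm⟩ := hcr
      refine ⟨-m - c, ?_⟩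
      rw [Nat.cast_sub (by omega)]
      linear_combination -hm
  · rintro s t ⟨hs0, hs1, hs⟩ ⟨ht0, ht1, ht⟩
    have hcop : IsCoprime (w : ℤ) c := ⟨b, a, by rw [← hab]; ring⟩
    have hsum : ¬ (w : ℤ) ∣ c * (s + t) := by
      intro hd
      have := Int.le_of_dvd (by omega) (hcop.dvd_of_dvd_mul_left hd)
      omega
    have hdiff : (w : ℤ) ∣ c * (s - t) → s = t := by
      intro hd
      have := Int.eq_zero_of_abs_lt_dvd (hcop.dvd_of_dvd_mul_left hd) (by
        rw [abs_lt]
        omega)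
      omega
    rcases hs with hs | hs <;> rcases ht with ht | ht
    · have := dvd_sub ht hs
      exact hdiff (by rwa [show 1 - c * t - (1 - c * s) = c * ((s : ℤ) - t) by ring] at this)
    · have := dvd_add ht hs
      exact absurd
        (by rwa [show -1 - c * t + (1 - c * s) = -(c * ((s : ℤ) + t)) by ring, dvd_neg] at this)
        hsum
    · have := dvd_add ht hs
      exact absurd
        (by rwa [show 1 - c * t + (-1 - c * s) = -(c * ((s : ℤ) + t)) by ring, dvd_neg] at this)
        hsum
    · have := dvd_sub ht hs
      exact hdiff (by rwa [show -1 - c * t - (-1 - c * s) = c * ((s : ℤ) - t) by ring] at this)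

theorem tune_spec {p q : ℕ} (h : IsEvenParameter p q) : IsTune p q (tune p q) :=
  Nat.sInf_mem (existsUnique_tune h).exists

theorem existsUnique_kappa {p q : ℕ} (h : IsEvenParameter p q) : ∃! n, IsKappa p q n := by
  obtain ⟨h0, h1, _⟩ := tune_spec h
  have hw : (0 : ℝ) < omega p q := by exact_mod_cast (by omega : 0 < omega p q)
  have hlt : 2 * (tune p q : ℝ) < omega p q := by exact_mod_cast h1
  have hd : (0 : ℝ) < omega p q - 2 * tune p q := by linarith
  have hiff : ∀ n, IsKappa p q n ↔
      ⌊(tune p q : ℝ) / ((omega p q : ℝ) - 2 * (tune p q : ℝ))⌋₊ = n := by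
    intro n
    rw [Nat.floor_eq_iff (by positivity), IsKappa]
    have hn : (0 : ℝ) < 2 * (n : ℝ) + 1 := by positivity
    have hn' : (0 : ℝ) < 2 * ((n : ℝ) + 1) + 1 := by positivity
    rw [div_le_div_iff₀ hn hw, div_lt_div_iff₀ hw hn', le_div_iff₀ hd, div_lt_iff₀ hd]
    constructor <;> rintro ⟨h2, h3⟩ <;> constructor <;> linarith
  exact ⟨_, (hiff _).2 rfl, fun n hn => ((hiff n).1 hn).symm⟩

theorem kappa_spec {p q : ℕ} (h : IsEvenParameter p q) : IsKappa p q (kappa p q) :=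
  Nat.sInf_mem (existsUnique_kappa h).exists

end Plaid

end

/-! On a `P`- or `Q`-line of intercept `b` the mass function is constant, equal to `[Pb+1]_2`; on a
grid line of coordinate `l` the capacity is `[2Pl]_2`. Lightness of a crossing therefore depends
only on `b` and `l`, and it becomes a parity condition on the integer parts of `Pb`, `2Pl` and
`P(b-2l)` (`light_iff_floor`, `LightAt`). Inside the rectangle each edge that is not on `x = 0` has
exactly two candidate crossings, whose intercepts are themselves given by integer parts. A good edge
is thus the exclusive or of two light conditions. It remains to compare integer parts for the two
parameters. Since `P' - P = ±2/(ωω')`, an integer separating `Pb` from `P'b` forces `2|b| ≥ ω + ω'`,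
apart from boundary cases (`Neighbors.slantFloor_eq`). The one grid line where `⌊2Pl⌋` changes is
`4l = ω + ω'`; there both light conditions are negated, which leaves the exclusive or unchanged
(`Neighbors.lightAt_iff_not`). The tunes are explicit in `ω` and `ω'`, `κ = 0` amounts to `ω < 3ω'`,
and for `Σ' = [0,W] × [0,H]` this gives `2H + 4W ≤ ω + ω'`, which keeps all intercepts in the range
of the comparison. -/

noncomputable section
namespace Plaid

/-! ### Integer parts of the multiples of `P` -/

/-- The integer part of `P * b`. -/
def slantFloor (p q : ℕ) (b : ℤ) : ℤ := 2 * p * b / (omega p q : ℤ)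

/-- The parity form of the light point condition, for a slanting line of intercept `b` and a
grid line of coordinate `l`. -/
def LightAt (p q : ℕ) (b l : ℤ) : Prop :=
  slantFloor p q (2 * l) % 2 = slantFloor p q (b - 2 * l) % 2 ∧
    slantFloor p q b % 2 ≠ slantFloor p q (2 * l) % 2

theorem isCoprime_two_mul_omega {p q : ℕ} (h : IsEvenParameter p q) :
    IsCoprime (omega p q : ℤ) (2 * p : ℤ) := by
  have := Nat.isCoprime_iff_coprime.2 (coprime_two_mul_omega h)
  push_cast at this
  exact this.symm

theorem omega_emod_two {p q : ℕ} (h : IsEvenParameter p q) : (omega p q : ℤ) % 2 = 1 := by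
  have := (Nat.coprime_two_left).1 (Nat.Coprime.coprime_dvd_left
    (Dvd.intro p rfl : 2 ∣ 2 * p) (coprime_two_mul_omega h))
  have := Nat.odd_iff.1 this
  omega

theorem three_le_omega {p q : ℕ} (h : IsEvenParameter p q) : (3 : ℤ) ≤ omega p q := by
  obtain ⟨h0, h1, _⟩ := h
  unfold omega
  omega

/-- A quotient together with its remainder. -/
theorem exists_slantFloor_add {p q : ℕ} (h : IsEvenParameter p q) (b : ℤ) :
    ∃ r : ℤ, 0 ≤ r ∧ r < omega p q ∧ 2 * p * b = slantFloor p q b * omega p q + r := by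
  have hw := three_le_omega h
  refine ⟨2 * p * b % omega p q, Int.emod_nonneg _ (by omega), Int.emod_lt_of_pos _ (by omega), ?_⟩
  rw [slantFloor, mul_comm (_ / _)]
  exact (Int.mul_ediv_add_emod _ _).symm

theorem slantFloor_eq {p q : ℕ} (h : IsEvenParameter p q) {b n r : ℤ}
    (hn : 2 * p * b = n * omega p q + r) (h0 : 0 ≤ r) (h1 : r < omega p q) :
    slantFloor p q b = n := by
  have hw := three_le_omega h
  rw [slantFloor, hn, add_comm, Int.add_mul_ediv_right _ _ (by omega), Int.ediv_eq_zero_of_lt h0 h1,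
    zero_add]

theorem omega_dvd_of_dvd {p q : ℕ} (h : IsEvenParameter p q) {b : ℤ}
    (hd : (omega p q : ℤ) ∣ 2 * p * b) : (omega p q : ℤ) ∣ b :=
  (isCoprime_two_mul_omega h).dvd_of_dvd_mul_left hd

theorem slantFloor_zero (p q : ℕ) : slantFloor p q 0 = 0 := by simp [slantFloor]

theorem not_lightAt_zero (p q : ℕ) (b : ℤ) : ¬ LightAt p q b 0 := by
  simp only [LightAt, mul_zero, sub_zero, slantFloor_zero]
  omega

theorem slantFloor_nonneg {p q : ℕ} {b : ℤ} (hb : 0 ≤ b) : 0 ≤ slantFloor p q b :=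
  Int.ediv_nonneg (by positivity) (by positivity)

theorem slantFloor_le {p q : ℕ} (h : IsEvenParameter p q) {b : ℤ} (hb : 0 ≤ b) :
    slantFloor p q b ≤ b := by
  have hw := three_le_omega h
  rw [slantFloor]
  apply Int.ediv_le_of_le_mul (by omega)
  rw [mul_comm]
  have : (2 * p : ℤ) ≤ omega p q := by
    have := h.2.1
    unfold omega
    push_cast
    omega
  gcongr

/-! ### Comparison of two neighboring parameters -/

/-- Two even rational parameters with `p'ω - pω' = ε`, `ε = ±1`, and `ω' < ω < 3ω'`. -/
structure Neighbors (p' q' p q : ℕ) (ε : ℤ) : Prop where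
  left : IsEvenParameter p' q'
  right : IsEvenParameter p q
  sign : ε = 1 ∨ ε = -1
  det : (p' : ℤ) * omega p q - p * omega p' q' = ε
  lt : (omega p' q' : ℤ) < omega p q
  lt_three : (omega p q : ℤ) < 3 * omega p' q'

variable {p q p' q' : ℕ} {ε : ℤ}

/-- `Pb` and `P'b` are `2|b|/(ωω')` apart. A nonintegral multiple of `1/ω` is at least `1/ω` from
every integer, and likewise for `ω'`, so an integer between them costs `(ω+ω')/(ωω')`. At `b = ±ω'`
the number `P'b` is itself an integer, whence the exclusion. -/
theorem Neighbors.slantFloor_eq (h : Neighbors p' q' p q ε) {b : ℤ}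
    (h1 : 2 * b < omega p q + omega p' q') (h2 : -(2 * b) < omega p q + omega p' q')
    (h3 : b ≠ omega p' q') (h4 : b ≠ -omega p' q') :
    slantFloor p' q' b = slantFloor p q b := by
  rcases eq_or_ne b 0 with rfl | hb
  · simp [slantFloor_zero]
  obtain ⟨hl, hr, hs, hd, hlt, hlt3⟩ := h
  obtain ⟨r', hr0', hr1', hr'⟩ := exists_slantFloor_add hl b
  obtain ⟨r, hr0, hr1, hr2⟩ := exists_slantFloor_add hr b
  have hw' := three_le_omega hl
  have hrne : r ≠ 0 := by
    rintro rfl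
    have := omega_dvd_of_dvd hr (b := b) ⟨_, by rw [hr2, add_zero, mul_comm]⟩
    exact hb (Int.eq_zero_of_abs_lt_dvd this (by rw [abs_lt]; omega))
  have hrne' : r' ≠ 0 := by
    rintro rfl
    obtain ⟨c, hc⟩ := omega_dvd_of_dvd hl (b := b) ⟨_, by rw [hr', add_zero, mul_comm]⟩
    -- `ω < 3ω'` gives `|b| < 2ω'`, so the only multiples of `ω'` in range are `0` and `±ω'`.
    have hc1 : c < 2 := by nlinarith
    have hc2 : -2 < c := by nlinarith
    interval_cases c <;> simp_all
  generalize slantFloor p' q' b = n' at *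
  generalize slantFloor p q b = n at *
  generalize (omega p' q' : ℤ) = w' at *
  generalize (omega p q : ℤ) = w at *
  have key : 2 * b * ε = (n' - n) * (w * w') + r' * w - r * w' := by
    linear_combination (-2 * b) * hd + w * hr' - w' * hr2
  have hub : 2 * b * ε < w + w' := by rcases hs with rfl | rfl <;> linarith
  have hlb : -(w + w') < 2 * b * ε := by rcases hs with rfl | rfl <;> linarith
  have hww : 0 < w * w' := by apply mul_pos <;> omega
  have hr0 : 1 ≤ r := by omega
  have hr0' : 1 ≤ r' := by omega
  have e1 : r * w' ≤ (w - 1) * w' := by gcongr; omega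
  have e2 : r' * w ≤ (w' - 1) * w := by gcongr <;> omega
  have e3 : 1 * w' ≤ r * w' := by gcongr
  have e4 : 1 * w ≤ r' * w := by gcongr; omega
  rcases lt_trichotomy n' n with hn | hn | hn
  · have : (n' - n) * (w * w') ≤ (-1) * (w * w') := by gcongr; omega
    nlinarith
  · exact hn
  · have : 1 * (w * w') ≤ (n' - n) * (w * w') := by gcongr; omega
    nlinarith

/-- For even arguments the range is twice as long because parity helps: `ω` is odd and `4pl` even,
so each remainder has the parity of its quotient. The distances `a/ω'` and `a'/ω` to a separating
integer then satisfy `a ≡ a'` mod 2 and `aω + a'ω' = 4l < 4ω'`, which leaves only `a = a' = 1`. -/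
theorem Neighbors.slantFloor_two_mul_eq (h : Neighbors p' q' p q ε) {l : ℤ} (h0 : 0 ≤ l)
    (h1 : l < omega p' q') (h2 : 4 * l ≠ omega p q + omega p' q') :
    slantFloor p' q' (2 * l) = slantFloor p q (2 * l) := by
  rcases eq_or_ne l 0 with rfl | hb
  · simp [slantFloor_zero]
  obtain ⟨hl, hr, hs, hd, hlt, hlt3⟩ := h
  obtain ⟨r', hr0', hr1', hr'⟩ := exists_slantFloor_add hl (2 * l)
  obtain ⟨r, hr0, hr1, hr2⟩ := exists_slantFloor_add hr (2 * l)
  have hw' := three_le_omega hl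
  have ho' := omega_emod_two hl
  have ho := omega_emod_two hr
  have aux : ∀ {p q : ℕ} (_ : IsEvenParameter p q), l < omega p q →
      ¬ (omega p q : ℤ) ∣ 2 * p * (2 * l) := by
    intro p q hp hlp hdv
    have h3 := omega_dvd_of_dvd hp hdv
    have h4 : IsCoprime (omega p q : ℤ) 2 :=
      (isCoprime_two_mul_omega hp).of_isCoprime_of_dvd_right (Dvd.intro _ rfl)
    exact hb (Int.eq_zero_of_abs_lt_dvd (h4.dvd_of_dvd_mul_left h3) (by rw [abs_lt]; omega))
  have hrne : r ≠ 0 := by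
    rintro rfl
    exact aux hr (by omega) ⟨_, by rw [hr2, add_zero, mul_comm]⟩
  have hrne' : r' ≠ 0 := by
    rintro rfl
    exact aux hl (by omega) ⟨_, by rw [hr', add_zero, mul_comm]⟩
  have par : ∀ {c n w r : ℤ}, w % 2 = 1 → 2 * c * (2 * l) = n * w + r → r % 2 = n % 2 := by
    intro c n w r hw hc
    have h5 : (n * w) % 2 = n % 2 := by rw [Int.mul_emod, hw]; simp
    have h6 : (2 * c * (2 * l)) % 2 = 0 := by
      rw [mul_assoc]; exact Int.mul_emod_right 2 _
    omega
  have hp := par ho hr2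
  have hp' := par ho' hr'
  generalize slantFloor p' q' (2 * l) = n' at *
  generalize slantFloor p q (2 * l) = n at *
  generalize (omega p' q' : ℤ) = w' at *
  generalize (omega p q : ℤ) = w at *
  have key : 4 * l * ε = (n' - n) * (w * w') + r' * w - r * w' := by
    linear_combination (-4 * l) * hd + w * hr' - w' * hr2
  have hub : 4 * l * ε ≤ 4 * l := by rcases hs with rfl | rfl <;> linarith
  have hlb : -(4 * l) ≤ 4 * l * ε := by rcases hs with rfl | rfl <;> linarith
  have hww : 5 * w' ≤ w * w' := by gcongr; omega
  have small : ∀ a a' : ℤ, 1 ≤ a → 1 ≤ a' → a % 2 = a' % 2 → a * w + a' * w' ≤ 4 * l →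
      a = 1 ∧ a' = 1 := by
    intro a a' ha ha' hpar hle
    have ha3 : a < 3 := by
      by_contra hc
      have : 3 * w ≤ a * w := by gcongr <;> omega
      have : 1 * w' ≤ a' * w' := by gcongr
      omega
    have ha3' : a' < 3 := by
      by_contra hc
      have : 1 * w ≤ a * w := by gcongr; omega
      have : 3 * w' ≤ a' * w' := by gcongr; omega
      omega
    interval_cases a <;> interval_cases a' <;> omega
  rcases lt_trichotomy n' n with hn | hn | hn
  · rcases eq_or_ne n (n' + 1) with rfl | hne
    · have h7 : (w' - r') * w + r * w' = -(4 * l * ε) := by rw [key]; ring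
      obtain ⟨h8, rfl⟩ := small (w' - r') r (by omega) (by omega) (by omega) (by omega)
      rw [h8] at h7
      rcases hs with rfl | rfl <;> omega
    · have : (n' - n) * (w * w') ≤ (-2) * (w * w') := by gcongr <;> omega
      have : r' * w ≤ w' * w := by gcongr; omega
      have : 0 ≤ r * w' := by positivity
      nlinarith
  · exact hn
  · rcases eq_or_ne n' (n + 1) with rfl | hne
    · have h7 : r' * w + (w - r) * w' = 4 * l * ε := by rw [key]; ring
      obtain ⟨rfl, h8⟩ := small r' (w - r) (by omega) (by omega) (by omega) (by omega)
      rw [h8] at h7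
      rcases hs with rfl | rfl <;> omega
    · have : 2 * (w * w') ≤ (n' - n) * (w * w') := by gcongr <;> omega
      have : r * w' ≤ w * w' := by gcongr
      have : 0 ≤ r' * w := mul_nonneg hr0' (by omega)
      nlinarith

theorem slantFloor_omega (h : IsEvenParameter p q) : slantFloor p q (omega p q) = 2 * p :=
  Plaid.slantFloor_eq h (r := 0) (by ring) le_rfl (by have := three_le_omega h; omega)

theorem Neighbors.slantFloor_omega (h : Neighbors p' q' p q ε) :
    slantFloor p q (omega p' q') = if ε = 1 then 2 * (p' : ℤ) - 1 else 2 * p' := by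
  obtain ⟨hl, hr, hs, hd, hlt, hlt3⟩ := h
  have := three_le_omega hr
  rcases hs with rfl | rfl
  · exact Plaid.slantFloor_eq hr (r := omega p q - 2) (by simp; linear_combination -2 * hd)
      (by omega) (by omega)
  · exact Plaid.slantFloor_eq hr (r := 2) (by simp; linear_combination -2 * hd)
      (by omega) (by omega)

/-- Light points agree away from the line of coordinate `(ω + ω') / 4`. -/
theorem Neighbors.lightAt_iff (h : Neighbors p' q' p q ε) {b l : ℤ} (hl0 : 0 ≤ l)
    (hl1 : l < omega p' q') (hl2 : 4 * l ≠ omega p q + omega p' q') (hb0 : 0 ≤ b)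
    (hb1 : 2 * b < omega p q + omega p' q') (hb2 : b - 2 * l < omega p' q')
    (hb3 : -omega p' q' < b - 2 * l) :
    LightAt p' q' b l ↔ LightAt p q b l := by
  have hg := h.slantFloor_two_mul_eq hl0 hl1 hl2
  have hlt := h.lt
  have hh := h.slantFloor_eq (b := b - 2 * l) (by omega) (by omega) (by omega) (by omega)
  -- At `b = ω'` the integer parts of `Pb` and `P'b` may differ, but those of `P'·2l` and `P'(ω' -
  -- 2l)` have opposite parity, so neither parameter has a light point.
  rcases eq_or_ne b (omega p' q') with rfl | hb
  · obtain ⟨r, hr0, hr1, hr⟩ := exists_slantFloor_add h.left (2 * l)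
    have hr2 : r ≠ 0 := by
      rintro rfl
      have h1 := omega_dvd_of_dvd h.left (b := 2 * l) ⟨_, by rw [hr, add_zero, mul_comm]⟩
      have h4 : IsCoprime (omega p' q' : ℤ) 2 :=
        (isCoprime_two_mul_omega h.left).of_isCoprime_of_dvd_right (Dvd.intro _ rfl)
      have := Int.eq_zero_of_abs_lt_dvd (h4.dvd_of_dvd_mul_left h1) (by rw [abs_lt]; omega)
      omega
    have h5 : slantFloor p' q' (omega p' q' - 2 * l) = 2 * p' - slantFloor p' q' (2 * l) - 1 :=
      Plaid.slantFloor_eq h.left (r := omega p' q' - r) (by linear_combination -hr)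
        (by omega) (by omega)
    rw [LightAt, LightAt, ← hg, ← hh, h5]
    omega
  · rw [LightAt, LightAt, hg, hh, h.slantFloor_eq (b := b) hb1 (by omega) hb (by omega)]

/-- On the line of coordinate `(ω + ω') / 4` the light points get interchanged with the other
intersection points. -/
theorem Neighbors.lightAt_iff_not (h : Neighbors p' q' p q ε) {b l : ℤ}
    (hl1 : l < omega p' q') (hl2 : 4 * l = omega p q + omega p' q') (hb0 : l ≤ b)
    (hb1 : 2 * b < omega p q + omega p' q') :
    LightAt p' q' b l ↔ ¬ LightAt p q b l := by
  have hlt := h.lt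
  have hlt3 := h.lt_three
  have hw' := three_le_omega h.left
  have hd := h.det
  have hh := h.slantFloor_eq (b := b - 2 * l) (by omega) (by omega) (by omega) (by omega)
  have e' : 2 * p' * (2 * l) = ((p : ℤ) + p') * omega p' q' + ε := by
    linear_combination p' * hl2 + hd
  have e : 2 * p * (2 * l) = ((p : ℤ) + p') * omega p q - ε := by
    linear_combination p * hl2 - hd
  -- `2Pl` and `2P'l` lie on opposite sides of the odd integer `p + p'`, at distances `1/ω` and
  -- `1/ω'`: the capacities are near `±1` with opposite signs.
  have hN : ((p : ℤ) + p') % 2 = 1 := by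
    have h5 : (((p : ℤ) + p') * omega p' q') % 2 = ((p : ℤ) + p') % 2 := by
      rw [Int.mul_emod, omega_emod_two h.left]; simp
    have h6 : ((2 : ℤ) * p' * (2 * l)) % 2 = 0 := by
      rw [mul_assoc]; exact Int.mul_emod_right 2 _
    rcases h.sign with rfl | rfl <;> omega
  generalize hNN : (p : ℤ) + p' = N at *
  -- For the parameter whose value lies just above `N`, adding `2l` to the intercept raises the
  -- integer part by the odd number `N`. The parts at `b` and `b - 2l` then differ in parity, so
  -- lightness depends only on the parity of the part at `2l`, which is opposite for the two
  -- parameters.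
  have shift : ∀ {p q : ℕ}, IsEvenParameter p q → 2 * p * (2 * l) = N * omega p q + 1 →
      ¬ (omega p q : ℤ) ∣ b → slantFloor p q b = N + slantFloor p q (b - 2 * l) := by
    intro p q hp he hnd
    obtain ⟨r, hr0, hr1, hr⟩ := exists_slantFloor_add hp (b - 2 * l)
    have hr2 : r + 1 ≠ omega p q := by
      intro hr2
      refine hnd (omega_dvd_of_dvd hp ⟨slantFloor p q (b - 2 * l) + N + 1, ?_⟩)
      linear_combination hr + he + hr2
    exact Plaid.slantFloor_eq hp (r := r + 1) (by linear_combination hr + he) (by omega) (by omega)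
  rcases h.sign with rfl | rfl
  · have g' : slantFloor p' q' (2 * l) = N :=
      Plaid.slantFloor_eq h.left (r := 1) e' (by omega) (by omega)
    have g : slantFloor p q (2 * l) = N - 1 :=
      Plaid.slantFloor_eq h.right (r := omega p q - 1) (by rw [e]; ring) (by omega) (by omega)
    rcases eq_or_ne b (omega p' q') with rfl | hb
    · have f' := Plaid.slantFloor_omega h.left
      have f := h.slantFloor_omega
      rw [if_pos rfl] at f
      have hh' : slantFloor p' q' (omega p' q' - 2 * l) = 2 * p' - N - 1 :=
        Plaid.slantFloor_eq h.left (r := omega p' q' - 1) (by linear_combination -e')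
          (by omega) (by omega)
      rw [LightAt, LightAt, ← hh, hh', f, f', g, g']
      omega
    · have f' := shift h.left e' (by
        rintro ⟨c, hc⟩
        have hc1 : 0 < c := by nlinarith
        have hc2 : c < 2 := by nlinarith
        interval_cases c
        simp at hc
        exact hb hc)
      have f := h.slantFloor_eq (b := b) (by omega) (by omega) hb (by omega)
      rw [LightAt, LightAt, ← hh, ← f, f', g, g']
      omega
  · have g : slantFloor p q (2 * l) = N :=
      Plaid.slantFloor_eq h.right (r := 1) (by rw [e]; ring) (by omega) (by omega)
    have g' : slantFloor p' q' (2 * l) = N - 1 :=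
      Plaid.slantFloor_eq h.left (r := omega p' q' - 1) (by rw [e']; ring) (by omega) (by omega)
    have f := shift h.right (by rw [e]; ring) (by
      intro hdv
      have := Int.eq_zero_of_abs_lt_dvd hdv (by rw [abs_lt]; omega)
      omega)
    have f' : slantFloor p' q' b = slantFloor p q b := by
      rcases eq_or_ne b (omega p' q') with rfl | hb
      · rw [h.slantFloor_omega, Plaid.slantFloor_omega h.left, if_neg (by omega)]
      · exact h.slantFloor_eq (by omega) (by omega) hb (by omega)
    rw [LightAt, LightAt, hh, f', f, g, g']
    omega

/-- The capacity vanishes at `l = ω`: shifting the intercept by `2ω` changes the integer part by the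
even number `4p`, so the two parity requirements contradict each other. -/
theorem not_lightAt_omega (h : IsEvenParameter p q) (b : ℤ) : ¬ LightAt p q b (omega p q) := by
  have hw := three_le_omega h
  obtain ⟨r, hr0, hr1, hr⟩ := exists_slantFloor_add h b
  have e1 : slantFloor p q (2 * omega p q) = 4 * p :=
    slantFloor_eq h (r := 0) (by ring) le_rfl (by omega)
  have e2 : slantFloor p q (b - 2 * omega p q) = slantFloor p q b - 4 * p :=
    slantFloor_eq h (r := r) (by linear_combination hr) hr0 hr1
  rw [LightAt, e1, e2]
  omega

/-- Covers the top edge `y = ω'` of the strong case, where the capacity for `p/q` is not zero. Away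
from `b = ω'` the integer parts at `b` and `b - 2ω'` agree with those of `p'/q'`, which differ by
`4p'`. -/
theorem Neighbors.not_lightAt_omega (h : Neighbors p' q' p q ε)
    {b : ℤ} (hb0 : omega p' q' ≤ b) (hb1 : 2 * b < omega p q + omega p' q') :
    ¬ LightAt p q b (omega p' q') := by
  have hlt := h.lt
  have hlt3 := h.lt_three
  have hw' := three_le_omega h.left
  have ho' := omega_emod_two h.left
  have ho := omega_emod_two h.right
  have hd := h.det
  rcases eq_or_ne b (omega p' q') with rfl | hb
  · have f := h.slantFloor_omega
    rcases h.sign with rfl | rfl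
    · have g : slantFloor p q (2 * omega p' q') = 4 * p' - 1 :=
        Plaid.slantFloor_eq h.right (r := omega p q - 4) (by linear_combination -4 * hd)
          (by omega) (by omega)
      have hh : slantFloor p q (omega p' q' - 2 * omega p' q') = -2 * p' :=
        Plaid.slantFloor_eq h.right (r := 2) (by linear_combination 2 * hd)
          (by omega) (by omega)
      rw [LightAt, f, g, hh]
      omega
    · have g : slantFloor p q (2 * omega p' q') = 4 * p' :=
        Plaid.slantFloor_eq h.right (r := 4) (by linear_combination -4 * hd)
          (by omega) (by omega)
      have hh : slantFloor p q (omega p' q' - 2 * omega p' q') = -2 * p' - 1 :=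
        Plaid.slantFloor_eq h.right (r := omega p q - 2) (by linear_combination 2 * hd)
          (by omega) (by omega)
      rw [LightAt, f, g, hh]
      omega
  · have f := h.slantFloor_eq (b := b) (by omega) (by omega) (by omega) (by omega)
    have hh := h.slantFloor_eq (b := b - 2 * omega p' q') (by omega) (by omega) (by omega) (by omega)
    obtain ⟨r, hr0, hr1, hr⟩ := exists_slantFloor_add h.left b
    have e2 : slantFloor p' q' (b - 2 * omega p' q') = slantFloor p' q' b - 4 * p' :=
      Plaid.slantFloor_eq h.left (r := r) (by linear_combination hr) hr0 hr1
    rw [LightAt, ← f, ← hh, e2]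
    omega

/-! ### Lightness as a parity condition -/

theorem rep2_eq_sub (t : ℝ) : rep2 t = t - 2 * ⌊(t + 1) / 2⌋ := by
  rw [rep2, toIcoMod, toIcoDiv_eq_floor]
  simp
  ring

theorem rep2_of_even {t : ℝ} {n : ℤ} (hn : n % 2 = 0) (h0 : (n : ℝ) - 1 ≤ t) (h1 : t < n + 1) :
    rep2 t = t - n := by
  obtain ⟨m, rfl⟩ := Int.dvd_of_emod_eq_zero hn
  push_cast at h0 h1 ⊢
  rw [rep2_eq_sub, Int.floor_eq_iff.2 (⟨by linarith, by linarith⟩ :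
    (m : ℝ) ≤ (t + 1) / 2 ∧ (t + 1) / 2 < m + 1)]

/-- The light point condition, expressed through integer parts. -/
theorem light_iff_floor {α γ : ℝ} (h1 : ∀ n : ℤ, n % 2 = 1 → α ≠ n)
    (h2 : ∀ n : ℤ, n % 2 = 1 → α - γ ≠ n) :
    (|rep2 (α + 1)| < |rep2 γ| ∧ 0 < rep2 γ * rep2 (α + 1)) ↔
      ⌊γ⌋ % 2 = ⌊α - γ⌋ % 2 ∧ ⌊α⌋ % 2 ≠ ⌊γ⌋ % 2 := by
  have ha0 := Int.floor_le α
  have ha1 := Int.lt_floor_add_one α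
  have hg0 := Int.floor_le γ
  have hg1 := Int.lt_floor_add_one γ
  have ha2 := h1 ⌊α⌋
  have hd := h2 (⌊α⌋ - ⌊γ⌋)
  have hdif : ∀ n : ℤ, (n : ℝ) ≤ α - γ → α - γ < n + 1 → ⌊α - γ⌋ = n :=
    fun n h h' => Int.floor_eq_iff.2 ⟨h, h'⟩
  have hdif1 := hdif (⌊α⌋ - ⌊γ⌋)
  have hdif2 := hdif (⌊α⌋ - ⌊γ⌋ - 1)
  generalize ⌊α - γ⌋ = h at *
  generalize ⌊α⌋ = f at *
  generalize ⌊γ⌋ = g at *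
  push_cast at hdif1 hdif2 hd
  -- `[α+1]_2` is `{α}` or `{α} - 1` as `f` is odd or even, and `[γ]_2` is `{γ}` or `{γ} - 1` as `g`
  -- is even or odd. Equal signs need opposite parities; comparing absolute values then compares
  -- `{α}` with `{γ}`, that is, detects a borrow in `⌊α - γ⌋`.
  rcases Int.emod_two_eq_zero_or_one f with hf | hf <;>
    rcases Int.emod_two_eq_zero_or_one g with hg | hg
  · rw [rep2_of_even (t := α + 1) (n := f + 2) (by omega) (by push_cast; linarith)
      (by push_cast; linarith), rep2_of_even (t := γ) hg (by linarith) (by linarith)]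
    push_cast
    refine iff_of_false ?_ (by omega)
    rintro ⟨-, h4⟩
    have : (γ - g) * (α + 1 - (f + 2)) ≤ 0 :=
      mul_nonpos_of_nonneg_of_nonpos (by linarith) (by linarith)
    linarith
  · rw [rep2_of_even (t := α + 1) (n := f + 2) (by omega) (by push_cast; linarith)
      (by push_cast; linarith), rep2_of_even (t := γ) (n := g + 1) (by omega)
      (by push_cast; linarith) (by push_cast; linarith)]
    push_cast
    have hne := hd (by omega)
    rw [abs_of_neg (by linarith), abs_of_neg (by linarith)]
    constructor
    · rintro ⟨h3, -⟩
      rw [hdif1 (by linarith) (by linarith)]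
      omega
    · intro h3
      have hlt : γ - g < α - f := by
        by_contra hc
        rcases (not_lt.1 hc).lt_or_eq with hc | hc
        · have := hdif2 (by linarith) (by linarith)
          omega
        · exact hne (by linarith)
      exact ⟨by linarith, mul_pos_of_neg_of_neg (by linarith) (by linarith)⟩
  · rw [rep2_of_even (t := α + 1) (n := f + 1) (by omega) (by push_cast; linarith)
      (by push_cast; linarith), rep2_of_even (t := γ) hg (by linarith) (by linarith)]
    push_cast
    have hlt : (f : ℝ) < α := lt_of_le_of_ne ha0 (ha2 hf).symm
    rw [abs_of_pos (by linarith), abs_of_nonneg (by linarith)]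
    constructor
    · rintro ⟨h3, -⟩
      rw [hdif2 (by linarith) (by linarith)]
      omega
    · intro h3
      have hlt' : α - f < γ - g := by
        by_contra hc
        have := hdif1 (by linarith) (by linarith)
        omega
      exact ⟨by linarith, mul_pos (by linarith) (by linarith)⟩
  · rw [rep2_of_even (t := α + 1) (n := f + 1) (by omega) (by push_cast; linarith)
      (by push_cast; linarith), rep2_of_even (t := γ) (n := g + 1) (by omega)
      (by push_cast; linarith) (by push_cast; linarith)]
    push_cast
    refine iff_of_false ?_ (by omega)
    rintro ⟨-, h4⟩
    have : (γ - (g + 1)) * (α + 1 - (f + 1)) ≤ 0 :=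
      mul_nonpos_of_nonpos_of_nonneg (by linarith) (by linarith)
    linarith

theorem omega_pos (h : IsEvenParameter p q) : (0 : ℝ) < omega p q := by
  have := three_le_omega h
  exact_mod_cast (by omega : (0 : ℤ) < omega p q)

theorem slopeP_mul_eq_iff (h : IsEvenParameter p q) (b n : ℤ) :
    slopeP p q * b = n ↔ 2 * (p : ℤ) * b = n * omega p q := by
  have hw := omega_pos h
  rw [slopeP, div_mul_eq_mul_div, div_eq_iff hw.ne']
  norm_cast

theorem floor_slopeP_mul (p q : ℕ) (b : ℤ) : ⌊slopeP p q * b⌋ = slantFloor p q b := by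
  rw [slantFloor, slopeP, div_mul_eq_mul_div, Int.floor_div_natCast]
  congr 1
  exact Int.floor_eq_iff.2 ⟨by push_cast; exact le_rfl, by push_cast; linarith⟩

theorem slopeP_add_slopeQ (h : IsEvenParameter p q) : slopeP p q + slopeQ p q = 2 := by
  have hw := omega_pos h
  rw [slopeP, slopeQ, ← add_div, div_eq_iff hw.ne', omega]
  push_cast
  ring

theorem slopeP_pos (h : IsEvenParameter p q) : 0 < slopeP p q := by
  have hw := omega_pos h
  have : (0 : ℝ) < p := by exact_mod_cast h.1
  rw [slopeP]
  positivity

theorem slopeP_lt_one (h : IsEvenParameter p q) : slopeP p q < 1 := by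
  have hw := omega_pos h
  rw [slopeP, div_lt_one hw]
  have := h.2.1
  unfold omega
  exact_mod_cast (by omega : 2 * p < p + q)

theorem slopeP_mul_ne_odd (h : IsEvenParameter p q) (b : ℤ) {n : ℤ} (hn : n % 2 = 1) :
    slopeP p q * b ≠ n := by
  rw [Ne, slopeP_mul_eq_iff h]
  intro he
  have h5 : (n * omega p q) % 2 = 1 := by rw [Int.mul_emod, omega_emod_two h, hn]; rfl
  rw [← he, mul_assoc, Int.mul_emod_right] at h5
  omega

theorem lightAt_iff_rep2 (h : IsEvenParameter p q) (b l : ℤ) :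
    (|rep2 (slopeP p q * b + 1)| < |rep2 (2 * slopeP p q * l)| ∧
      0 < rep2 (2 * slopeP p q * l) * rep2 (slopeP p q * b + 1)) ↔ LightAt p q b l := by
  have e : slopeP p q * b - 2 * slopeP p q * l = slopeP p q * ((b - 2 * l : ℤ) : ℝ) := by
    push_cast
    ring
  have e' : 2 * slopeP p q * l = slopeP p q * ((2 * l : ℤ) : ℝ) := by
    push_cast
    ring
  rw [light_iff_floor (fun n hn => slopeP_mul_ne_odd h b hn)
    (fun n hn => by rw [e]; exact slopeP_mul_ne_odd h _ hn), e, e', floor_slopeP_mul,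
    floor_slopeP_mul, floor_slopeP_mul, LightAt]

/-- The slope, up to sign, of a family of slanting lines. -/
def slope (p q : ℕ) : Slant → ℝ
  | Slant.P => slopeP p q
  | Slant.Q => slopeQ p q

/-- The coordinate that is constant on the lines of a grid family. -/
def gridCoord : Grid → ℝ × ℝ → ℝ
  | Grid.H, z => z.2
  | Grid.V, z => z.1

theorem isLight_iff (h : IsEvenParameter p q) {A : Grid} {z : ℝ × ℝ} {l : ℤ}
    (hz : gridCoord A z = l) :
    IsLight p q A z ↔ ∃ (B : Slant) (b : ℤ), slope p q B * z.1 = b - z.2 ∧ LightAt p q b l := by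
  have hcap : capacityFn p q A z = rep2 (2 * slopeP p q * l) := by
    cases A <;> simp_all [capacityFn, gridCoord]
  have hgrid : OnGrid A z := by
    cases A <;> exact ⟨l, hz⟩
  have hmass : ∀ (B : Slant) (b : ℤ), slope p q B * z.1 = b - z.2 →
      massFn p q B z = rep2 (slopeP p q * b + 1) := by
    intro B b hb
    have hb' : (b : ℝ) = slope p q B * z.1 + z.2 := by linarith
    cases B <;> simp only [massFn, slope] at hb' ⊢ <;> rw [hb'] <;> ring_nf
  have hon : ∀ B : Slant, OnSlant p q B z ↔ ∃ b : ℤ, slope p q B * z.1 = b - z.2 := by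
    intro B
    cases B <;> refine exists_congr fun b => ?_ <;> simp only [slope] <;>
      constructor <;> intro h <;> linarith
  rw [IsLight, hcap]
  constructor
  · rintro ⟨-, B, hB, hl⟩
    obtain ⟨b, hb⟩ := (hon B).1 hB
    rw [hmass B b hb] at hl
    exact ⟨B, b, hb, (lightAt_iff_rep2 h b l).1 hl⟩
  · rintro ⟨B, b, hb, hl⟩
    refine ⟨hgrid, B, (hon B).2 ⟨b, hb⟩, ?_⟩
    rw [hmass B b hb]
    exact (lightAt_iff_rep2 h b l).2 hl

/-! ### Good edges through their two candidate crossings -/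

theorem encard_eq_one_iff_xor {α : Type*} {S : Set α} {a b : α} (hab : a ≠ b) {A B : Prop}
    (hS : ∀ x, x ∈ S ↔ (x = a ∧ A) ∨ (x = b ∧ B)) : S.encard = 1 ↔ Xor A B := by
  have e : S = {x | (x = a ∧ A) ∨ (x = b ∧ B)} := Set.ext hS
  subst e
  by_cases hA : A <;> by_cases hB : B
  · have : {x | (x = a ∧ A) ∨ (x = b ∧ B)} = ({a, b} : Set α) := by ext; simp [hA, hB]
    rw [this, Set.encard_pair hab]
    simp [Xor, hA, hB]
  · simp [Xor, hA, hB]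
  · simp [Xor, hA, hB]
  · simp [Xor, hA, hB]

theorem slantFloor_lt (h : IsEvenParameter p q) {k : ℤ} (h0 : 0 < k) (h1 : k < omega p q) :
    (slantFloor p q k : ℝ) < slopeP p q * k := by
  rw [← floor_slopeP_mul]
  refine lt_of_le_of_ne (Int.floor_le _) fun he => ?_
  have := Int.eq_zero_of_abs_lt_dvd (omega_dvd_of_dvd h (b := k)
    ⟨_, by rw [(slopeP_mul_eq_iff h k _).1 he.symm, mul_comm]⟩) (by rw [abs_lt]; omega)
  omega

theorem lt_slantFloor_add_one (p q : ℕ) (k : ℤ) : slopeP p q * k < slantFloor p q k + 1 := by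
  rw [← floor_slopeP_mul]
  exact Int.lt_floor_add_one _

theorem isGood_vertical_zero (h : IsEvenParameter p q) (j : ℤ) : ¬ IsGood p q Grid.V 0 j := by
  have : lightPoints p q Grid.V 0 j = ∅ := by
    refine Set.eq_empty_iff_forall_notMem.2 ?_
    rintro z ⟨hz, hl⟩
    rw [isLight_iff h (A := Grid.V) (l := 0) hz.1] at hl
    obtain ⟨B, b, -, hb⟩ := hl
    exact not_lightAt_zero p q b hb
  simp [IsGood, lightCount, this]

/-- As `P + Q = 2`, the `P`- and `Q`-crossings on `x = k` are mirror images modulo 1, and neither is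
an integer point for `0 < k < ω`. Each unit edge thus carries one of each, and they are distinct
because `2Pk` is never an odd integer. -/
theorem isGood_vertical_iff (h : IsEvenParameter p q) {k : ℤ} (j : ℤ) (h0 : 0 < k)
    (h1 : k < omega p q) :
    IsGood p q Grid.V k j ↔ Xor (LightAt p q (j + 1 + slantFloor p q k) k)
      (LightAt p q (j + 2 * k - slantFloor p q k) k) := by
  have hf0 := slantFloor_lt h h0 h1
  have hf1 := lt_slantFloor_add_one p q k
  have hPQ := slopeP_add_slopeQ h
  have hQ : slopeQ p q * k = 2 * k - slopeP p q * k := by linear_combination (k : ℝ) * hPQ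
  have hne : 2 * (slopeP p q * k) ≠ 2 * slantFloor p q k + 1 := by
    have := slopeP_mul_ne_odd h (2 * k) (n := 2 * slantFloor p q k + 1) (by omega)
    push_cast at this
    intro he
    exact this (by linarith)
  rw [IsGood, lightCount]
  generalize slantFloor p q k = f at *
  refine encard_eq_one_iff_xor (a := ((k : ℝ), (j + 1 + f : ℝ) - slopeP p q * k))
    (b := ((k : ℝ), (j - f : ℝ) + slopeP p q * k)) ?_ ?_
  · intro he
    have := congrArg Prod.snd he
    simp only at this
    exact hne (by linarith)
  · rintro ⟨x, y⟩
    simp only [lightPoints, unitSegment, Set.mem_ofPred_eq, Set.mem_prod, Set.mem_singleton_iff,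
      Set.mem_Icc, Prod.mk.injEq]
    constructor
    · rintro ⟨⟨rfl, hy0, hy1⟩, hl⟩
      rw [isLight_iff h (l := k) rfl] at hl
      obtain ⟨B, b, hb, hl⟩ := hl
      cases B
      · left
        simp only [slope] at hb
        have c1 : j + f < b := by exact_mod_cast (by linarith : (j + f : ℝ) < b)
        have c2 : b < j + f + 2 := by exact_mod_cast (by linarith : (b : ℝ) < j + f + 2)
        obtain rfl : b = j + 1 + f := by omega
        push_cast at hb
        exact ⟨⟨rfl, by linarith⟩, hl⟩
      · right
        simp only [slope] at hb
        rw [hQ] at hb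
        have c1 : j + 2 * k - f - 1 < b := by
          exact_mod_cast (by linarith : (j + 2 * k - f - 1 : ℝ) < b)
        have c2 : b < j + 2 * k - f + 1 := by
          exact_mod_cast (by linarith : (b : ℝ) < j + 2 * k - f + 1)
        obtain rfl : b = j + 2 * k - f := by omega
        push_cast at hb
        exact ⟨⟨rfl, by linarith⟩, hl⟩
    · rintro (⟨⟨rfl, rfl⟩, hl⟩ | ⟨⟨rfl, rfl⟩, hl⟩)
      · refine ⟨⟨rfl, by linarith, by linarith⟩, (isLight_iff h (l := k) rfl).2
          ⟨Slant.P, _, ?_, hl⟩⟩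
        simp only [slope]
        push_cast
        ring
      · refine ⟨⟨rfl, by linarith, by linarith⟩, (isLight_iff h (l := k) rfl).2
          ⟨Slant.Q, _, ?_, hl⟩⟩
        simp only [slope]
        rw [hQ]
        push_cast
        ring

/-- The distance from the line `y = l` of the intercept of the second slanting line that meets
the horizontal edge `[i, i + 1] × {l}`. -/
def secondOffset (p q : ℕ) (i : ℤ) : ℤ :=
  if slantFloor p q (i + 1) = slantFloor p q i then 2 * i - slantFloor p q i + 1
  else slantFloor p q i + 1

theorem isGood_horizontal_iff (h : IsEvenParameter p q) {i : ℤ} (l : ℤ) (h0 : 0 ≤ i)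
    (h1 : 2 * i + 1 < omega p q) :
    IsGood p q Grid.H i l ↔ Xor (LightAt p q (l + (2 * i - slantFloor p q i)) l)
      (LightAt p q (l + secondOffset p q i) l) := by
  have hw := three_le_omega h
  have hu1 := lt_slantFloor_add_one p q i
  have hu0 : (slantFloor p q i : ℝ) ≤ slopeP p q * i := by
    rw [← floor_slopeP_mul]
    exact Int.floor_le _
  have hu0' : 0 < i → (slantFloor p q i : ℝ) < slopeP p q * i :=
    fun hi => slantFloor_lt h hi (by omega)
  have hv0 := slantFloor_lt h (k := i + 1) (by omega) (by omega)
  have hv1 := lt_slantFloor_add_one p q (i + 1)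
  have hPQ := slopeP_add_slopeQ h
  have hP0 := slopeP_pos h
  have hP1 := slopeP_lt_one h
  have hQ0 : 0 < slopeQ p q := by linarith
  have hne : ∀ n : ℤ, slopeP p q * (2 * i + 1) ≠ 2 * n := by
    intro n he
    have := (slopeP_mul_eq_iff h (2 * i + 1) (2 * n)).1 (by push_cast; exact he)
    have := Int.eq_zero_of_abs_lt_dvd (omega_dvd_of_dvd h (b := 2 * i + 1)
      ⟨_, by rw [this, mul_comm]⟩) (by rw [abs_lt]; omega)
    omega
  have hz : i = 0 → slantFloor p q i = 0 := by
    rintro rfl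
    exact slantFloor_zero p q
  rw [secondOffset]
  push_cast at hv0 hv1
  generalize slantFloor p q (i + 1) = v at *
  generalize slantFloor p q i = u at *
  have hQi : slopeQ p q * i = 2 * i - slopeP p q * i := by linear_combination (i : ℝ) * hPQ
  have hQi1 : slopeQ p q * (i + 1) = 2 * (i + 1) - slopeP p q * (i + 1) := by
    linear_combination (i + 1 : ℝ) * hPQ
  have hv : v = u ∨ v = u + 1 := by
    have c1 : u < v + 1 := by exact_mod_cast (by linarith : (u : ℝ) < v + 1)
    have c2 : v < u + 2 := by exact_mod_cast (by linarith : (v : ℝ) < u + 2)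
    omega
  -- A crossing at the midpoint would make `ω` divide `2i + 1 < ω`, so the double counting never
  -- occurs here.
  have hmid : lightPoints p q Grid.H i l ∩ {segmentMid Grid.H i l} = ∅ := by
    refine Set.eq_empty_iff_forall_notMem.2 ?_
    rintro z ⟨⟨-, hl⟩, rfl⟩
    rw [isLight_iff h (l := l) rfl] at hl
    obtain ⟨B, b, hb, -⟩ := hl
    simp only [segmentMid] at hb
    cases B <;> simp only [slope] at hb
    · exact hne (b - l) (by push_cast; linarith)
    · refine hne (2 * i + 1 - (b - l)) ?_
      push_cast
      linear_combination (2 * i + 1 : ℝ) * hPQ - 2 * hb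
  rw [IsGood, lightCount, hmid, Set.encard_empty, add_zero]
  -- Crossings are integers `n = b - l` in `[Pi, P(i+1)]` or `[Qi, Q(i+1)]`. As `P + Q = 2`, the
  -- second interval has a second integer precisely when the first has none, except at `i = 0`.
  have hPint : ∀ n : ℤ, slopeP p q * i ≤ n → (n : ℝ) ≤ slopeP p q * (i + 1) →
      (i = 0 ∧ n = 0) ∨ (v = u + 1 ∧ n = u + 1) := by
    intro n hn0 hn1
    have c1 : n < v + 1 := by exact_mod_cast (by linarith : (n : ℝ) < v + 1)
    rcases h0.eq_or_lt with rfl | hi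
    · have c2 : u ≤ n := by exact_mod_cast (by linarith : (u : ℝ) ≤ n)
      have := hz rfl
      omega
    · have := hu0' hi
      have c2 : u < n := by exact_mod_cast (by linarith : (u : ℝ) < n)
      omega
  have hQint : ∀ n : ℤ, slopeQ p q * i ≤ n → (n : ℝ) ≤ slopeQ p q * (i + 1) →
      n = 2 * i - u ∨ (v = u ∧ n = 2 * i - u + 1) := by
    intro n hn0 hn1
    have c1 : n < 2 * i + 2 - v := by
      exact_mod_cast (by linarith : (n : ℝ) < 2 * i + 2 - v)
    have c2 : 2 * i - u - 1 < n := by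
      exact_mod_cast (by linarith : (2 * i - u - 1 : ℝ) < n)
    omega
  have hlight : ∀ (B : Slant) (n : ℤ), slope p q B * i ≤ n → (n : ℝ) ≤ slope p q B * (i + 1) →
      LightAt p q (l + n) l → ((n : ℝ) / slope p q B, (l : ℝ)) ∈ lightPoints p q Grid.H i l := by
    intro B n hn0 hn1 hl
    have hB : 0 < slope p q B := by cases B <;> assumption
    refine ⟨⟨⟨?_, ?_⟩, rfl⟩, (isLight_iff h (l := l) rfl).2 ⟨B, l + n, ?_, hl⟩⟩
    · exact (le_div_iff₀ hB).2 (by linarith)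
    · exact (div_le_iff₀ hB).2 (by linarith)
    · push_cast
      field_simp
      ring
  have hconv : ∀ z ∈ lightPoints p q Grid.H i l, ∃ (B : Slant) (n : ℤ),
      slope p q B * i ≤ n ∧ (n : ℝ) ≤ slope p q B * (i + 1) ∧ LightAt p q (l + n) l ∧
        z = ((n : ℝ) / slope p q B, (l : ℝ)) := by
    rintro ⟨x, y⟩ ⟨⟨⟨hx0, hx1⟩, hy⟩, hl⟩
    simp only [Set.mem_singleton_iff] at hy hx0 hx1
    subst hy
    rw [isLight_iff h (l := l) rfl] at hl
    obtain ⟨B, b, hb, hl⟩ := hl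
    have hB : 0 < slope p q B := by cases B <;> assumption
    refine ⟨B, b - l, ?_, ?_, by rwa [add_sub_cancel], ?_⟩
    · push_cast
      rw [← hb]
      gcongr
    · push_cast
      rw [← hb]
      gcongr
    · push_cast
      rw [← hb, mul_div_cancel_left₀ _ hB.ne']
  rcases hv with hv | hv
  · rw [if_pos hv]
    refine encard_eq_one_iff_xor (a := ((2 * i - u : ℤ) / slopeQ p q, (l : ℝ)))
      (b := ((2 * i - u + 1 : ℤ) / slopeQ p q, (l : ℝ))) ?_ ?_
    · intro he
      have := congrArg Prod.fst he
      simp only [div_left_inj' hQ0.ne'] at this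
      norm_cast at this
      omega
    · intro z
      constructor
      · intro hz'
        obtain ⟨B, n, hn0, hn1, hl, rfl⟩ := hconv z hz'
        cases B <;> simp only [slope] at hn0 hn1 ⊢
        -- At `i = 0` the `P`- and `Q`-lines of intercept `l` meet at the left endpoint, so they
        -- give one and the same light point.
        · rcases hPint n hn0 hn1 with ⟨hi, hn⟩ | ⟨hv', -⟩
          · left
            have hu := hz hi
            subst hn hi hu
            simpa using hl
          · omega
        · rcases hQint n hn0 hn1 with rfl | ⟨-, rfl⟩
          · exact Or.inl ⟨rfl, hl⟩
          · exact Or.inr ⟨rfl, hl⟩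
      · rintro (⟨rfl, hl⟩ | ⟨rfl, hl⟩)
        · exact hlight Slant.Q _ (by simp only [slope]; push_cast; linarith)
            (by simp only [slope]; push_cast; linarith) hl
        · subst hv
          exact hlight Slant.Q _ (by simp only [slope]; push_cast; linarith)
            (by simp only [slope]; push_cast; linarith) hl
  · rw [if_neg (by omega)]
    refine encard_eq_one_iff_xor (a := ((2 * i - u : ℤ) / slopeQ p q, (l : ℝ)))
      (b := ((u + 1 : ℤ) / slopeP p q, (l : ℝ))) ?_ ?_
    · intro he
      have := congrArg Prod.fst he
      simp only at this
      rw [div_eq_div_iff hQ0.ne' hP0.ne'] at this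
      refine hne (u + 1) ?_
      push_cast at this ⊢
      linear_combination this + (u + 1) * hPQ
    · intro z
      constructor
      · intro hz'
        obtain ⟨B, n, hn0, hn1, hl, rfl⟩ := hconv z hz'
        cases B <;> simp only [slope] at hn0 hn1 ⊢
        · rcases hPint n hn0 hn1 with ⟨hi, hn⟩ | ⟨-, rfl⟩
          · left
            have hu := hz hi
            subst hn hi hu
            simpa using hl
          · exact Or.inr ⟨rfl, hl⟩
        · rcases hQint n hn0 hn1 with rfl | ⟨hv', -⟩
          · exact Or.inl ⟨rfl, hl⟩
          · omega
      · subst hv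
        push_cast at hv0
        rintro (⟨rfl, hl⟩ | ⟨rfl, hl⟩)
        · exact hlight Slant.Q _ (by simp only [slope]; push_cast; linarith)
            (by simp only [slope]; push_cast; linarith) hl
        · exact hlight Slant.P _ (by simp only [slope]; push_cast; linarith)
            (by simp only [slope]; push_cast; linarith) hl

/-! ### From good edges to tilings on the rectangle -/

/-- Tilings whose good edges in an integer rectangle agree coincide in that rectangle. -/
theorem rectangle_inter_plaid_subset {p q p' q' : ℕ} {W H : ℤ}
    (hH : ∀ i l : ℤ, 0 ≤ i → i + 1 ≤ W → 0 ≤ l → l ≤ H →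
      IsGood p q Grid.H i l → IsGood p' q' Grid.H i l)
    (hV : ∀ k j : ℤ, 0 ≤ k → k ≤ W → 0 ≤ j → j + 1 ≤ H →
      IsGood p q Grid.V k j → IsGood p' q' Grid.V k j) :
    (Set.Icc (0 : ℝ) W ×ˢ Set.Icc (0 : ℝ) H) ∩ plaid p q ⊆ plaid p' q' := by
  rintro z ⟨⟨⟨hx0, hx1⟩, hy0, hy1⟩, hz⟩
  simp only [plaid, Set.mem_iUnion] at hz ⊢
  obtain ⟨i, j, A, k, l, he, hg, hs⟩ := hz
  refine ⟨i, j, A, k, l, he, ?_, hs⟩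
  rw [segment_eq_image] at hs
  obtain ⟨t, ⟨ht0, ht1⟩, rfl⟩ := hs
  cases A
  · obtain ⟨rfl, hl⟩ := he
    simp only [squareCenter, segmentMid, Prod.smul_mk, Prod.mk_add_mk, smul_eq_mul] at *
    have c1 : (-1 : ℤ) < k := by exact_mod_cast (by push_cast; linarith : ((-1 : ℤ) : ℝ) < k)
    have c2 : k < W := by exact_mod_cast (by linarith : (k : ℝ) < W)
    rcases hl with rfl | rfl
    · have c3 : (-1 : ℤ) < l := by exact_mod_cast (by push_cast; linarith : ((-1 : ℤ) : ℝ) < l)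
      have c4 : l ≤ H := by exact_mod_cast (by linarith : (l : ℝ) ≤ H)
      exact hH _ _ (by omega) (by omega) (by omega) c4 hg
    · push_cast at *
      -- `j = -1` is allowed: the square may lie outside the rectangle, but the edge carrying the
      -- segment does not.
      have c3 : (-2 : ℤ) < j := by exact_mod_cast (by push_cast; linarith : ((-2 : ℤ) : ℝ) < j)
      have c4 : j < H := by exact_mod_cast (by linarith : (j : ℝ) < H)
      exact hH _ _ (by omega) (by omega) (by omega) (by omega) hg
  · obtain ⟨hk, rfl⟩ := he
    simp only [squareCenter, segmentMid, Prod.smul_mk, Prod.mk_add_mk, smul_eq_mul] at *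
    have c1 : (-1 : ℤ) < l := by exact_mod_cast (by push_cast; linarith : ((-1 : ℤ) : ℝ) < l)
    have c2 : l < H := by exact_mod_cast (by linarith : (l : ℝ) < H)
    rcases hk with rfl | rfl
    · have c3 : (-1 : ℤ) < k := by exact_mod_cast (by push_cast; linarith : ((-1 : ℤ) : ℝ) < k)
      have c4 : k ≤ W := by exact_mod_cast (by linarith : (k : ℝ) ≤ W)
      exact hV _ _ (by omega) (by omega) (by omega) (by omega) hg
    · push_cast at *
      have c3 : (-2 : ℤ) < i := by exact_mod_cast (by push_cast; linarith : ((-2 : ℤ) : ℝ) < i)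
      have c4 : i < W := by exact_mod_cast (by linarith : (i : ℝ) < W)
      exact hV _ _ (by omega) (by omega) (by omega) (by omega) hg

theorem Neighbors.isGood_vertical_iff (h : Neighbors p' q' p q ε) {W H k j : ℤ}
    (hW : 2 * W < omega p' q') (hH : H ≤ omega p' q')
    (hHW : 2 * H + 4 * W ≤ omega p q + omega p' q')
    (hk0 : 0 ≤ k) (hk1 : k ≤ W) (hj0 : 0 ≤ j) (hj1 : j + 1 ≤ H) :
    IsGood p' q' Grid.V k j ↔ IsGood p q Grid.V k j := by
  have hlt := h.lt
  rcases hk0.eq_or_lt with rfl | hk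
  · exact iff_of_false (isGood_vertical_zero h.left j) (isGood_vertical_zero h.right j)
  rw [Plaid.isGood_vertical_iff h.left j hk (by omega),
    Plaid.isGood_vertical_iff h.right j hk (by omega),
    h.slantFloor_eq (b := k) (by omega) (by omega) (by omega) (by omega)]
  have f0 := slantFloor_nonneg (p := p) (q := q) hk0
  have f1 := slantFloor_le h.right hk0
  rw [h.lightAt_iff hk0 (by omega) (by omega) (by omega) (by omega) (by omega) (by omega),
    h.lightAt_iff hk0 (by omega) (by omega) (by omega) (by omega) (by omega) (by omega)]

theorem Neighbors.isGood_horizontal_iff (h : Neighbors p' q' p q ε) {W H i l : ℤ}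
    (hW : 2 * W < omega p' q') (hH : H ≤ omega p' q')
    (hHW : 2 * H + 4 * W ≤ omega p q + omega p' q')
    (hi0 : 0 ≤ i) (hi1 : i + 1 ≤ W) (hl0 : 0 ≤ l) (hl1 : l ≤ H) :
    IsGood p' q' Grid.H i l ↔ IsGood p q Grid.H i l := by
  have hlt := h.lt
  have e1 := h.slantFloor_eq (b := i) (by omega) (by omega) (by omega) (by omega)
  have e2 := h.slantFloor_eq (b := i + 1) (by omega) (by omega) (by omega) (by omega)
  have e3 : secondOffset p' q' i = secondOffset p q i := by
    rw [secondOffset, secondOffset, e1, e2]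
  rw [Plaid.isGood_horizontal_iff h.left l hi0 (by omega),
    Plaid.isGood_horizontal_iff h.right l hi0 (by omega), e1, e3]
  have f0 := slantFloor_nonneg (p := p) (q := q) hi0
  have f1 := slantFloor_le h.right hi0
  have s0 : 0 ≤ secondOffset p q i := by
    unfold secondOffset
    split <;> omega
  have s1 : secondOffset p q i < 2 * W := by
    unfold secondOffset
    split <;> omega
  rcases eq_or_ne l (omega p' q') with rfl | hl
  · have n1 := Plaid.not_lightAt_omega h.left
    have n2 := h.not_lightAt_omega (b := omega p' q' + (2 * i - slantFloor p q i))
      (by omega) (by omega)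
    have n3 := h.not_lightAt_omega (b := omega p' q' + secondOffset p q i) (by omega) (by omega)
    exact iff_of_false (by simp [Xor, n1]) (by simp [Xor, n2, n3])
  -- On the exceptional line both arguments of the exclusive or are negated.
  · by_cases hl2 : 4 * l = omega p q + omega p' q'
    · rw [h.lightAt_iff_not (by omega) hl2 (by omega) (by omega),
        h.lightAt_iff_not (by omega) hl2 (by omega) (by omega)]
      simp only [Xor]
      tauto
    · rw [h.lightAt_iff hl0 (by omega) (by omega) (by omega) (by omega) (by omega) (by omega),
        h.lightAt_iff hl0 (by omega) (by omega) (by omega) (by omega) (by omega) (by omega)]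

/-! ### Tunes and the size of `Σ'` -/

theorem tune_eq {t : ℕ} (h : IsEvenParameter p q) (ht : IsTune p q t) : tune p q = t :=
  (existsUnique_tune h).unique (tune_spec h) ht

/-- The tune of a parameter in terms of the neighbor with smaller denominator. -/
theorem two_mul_tune_right (hl : IsEvenParameter p' q') (hr : IsEvenParameter p q)
    (hs : ε = 1 ∨ ε = -1) (hd : (p' : ℤ) * omega p q - p * omega p' q' = ε)
    (hlt : (omega p' q' : ℤ) < omega p q) :
    2 * (tune p q : ℤ) = omega p q - omega p' q' := by
  have ho' := omega_emod_two hl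
  have ho := omega_emod_two hr
  have hw' := three_le_omega hl
  obtain ⟨t, ht⟩ : ∃ t : ℕ, (omega p q : ℤ) - omega p' q' = 2 * t :=
    ⟨((omega p q : ℤ) - omega p' q').toNat / 2, by omega⟩
  have htune : IsTune p q t := by
    refine ⟨by omega, by omega, ?_⟩
    have e : (2 * p * t : ℤ) = ε + omega p q * (p - p') := by
      linear_combination -p * ht + hd
    simp only [e, Int.modEq_iff_dvd]
    rcases hs with rfl | rfl
    · exact Or.inl ⟨p' - p, by ring⟩
    · exact Or.inr ⟨p' - p, by ring⟩
  rw [tune_eq hr htune, ht]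

/-- Modulo `ω'` one has `p'(ω - ω') ≡ ε`, so `(ω - ω')/2` is the tune if it is below `ω'/2`;
otherwise its reflection `ω' - (ω - ω')/2` is, positive by `ω < 3ω'`. -/
theorem Neighbors.two_mul_tune_left (h : Neighbors p' q' p q ε) :
    2 * (tune p' q' : ℤ) = if (omega p q : ℤ) < 2 * omega p' q' then
      (omega p q : ℤ) - omega p' q' else 3 * omega p' q' - omega p q := by
  obtain ⟨hl, hr, hs, hd, hlt, hlt3⟩ := h
  have ho' := omega_emod_two hl
  have ho := omega_emod_two hr
  split
  · obtain ⟨t, ht⟩ : ∃ t : ℕ, (omega p q : ℤ) - omega p' q' = 2 * t :=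
      ⟨((omega p q : ℤ) - omega p' q').toNat / 2, by omega⟩
    have htune : IsTune p' q' t := by
      refine ⟨by omega, by omega, ?_⟩
      have e : (2 * p' * t : ℤ) = ε + omega p' q' * (p - p') := by
        linear_combination -p' * ht + hd
      simp only [e, Int.modEq_iff_dvd]
      rcases hs with rfl | rfl
      · exact Or.inl ⟨p' - p, by ring⟩
      · exact Or.inr ⟨p' - p, by ring⟩
    rw [tune_eq hl htune, ht]
  · obtain ⟨t, ht⟩ : ∃ t : ℕ, 3 * (omega p' q' : ℤ) - omega p q = 2 * t :=
      ⟨(3 * (omega p' q' : ℤ) - omega p q).toNat / 2, by omega⟩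
    have htune : IsTune p' q' t := by
      refine ⟨by omega, by omega, ?_⟩
      have e : (2 * p' * t : ℤ) = -ε + omega p' q' * (3 * p' - p) := by
        linear_combination -p' * ht - hd
      simp only [e, Int.modEq_iff_dvd]
      rcases hs with rfl | rfl
      · exact Or.inr ⟨p - 3 * p', by ring⟩
      · exact Or.inl ⟨p - 3 * p', by ring⟩
    rw [tune_eq hl htune, ht]

theorem IsEvenPredecessor.neighbors (hpred : IsEvenPredecessor p' q' p q)
    (hκ : kappa p q = 0) : ∃ ε, Neighbors p' q' p q ε := by
  obtain ⟨hl, hr, hdet, hlt⟩ := hpred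
  have hd : (p' : ℤ) * omega p q - p * omega p' q' = p' * q - p * q' := by
    unfold omega
    push_cast
    ring
  have hs := eq_or_eq_neg_of_abs_eq hdet
  have hlt' : (omega p' q' : ℤ) < omega p q := by exact_mod_cast hlt
  have ht := two_mul_tune_right hl hr hs hd hlt'
  have hk := (kappa_spec hr).2
  rw [hκ, div_lt_div_iff₀ (omega_pos hr) (by norm_num)] at hk
  norm_num at hk
  have hk' : (tune p q : ℤ) * 3 < omega p q := by exact_mod_cast hk
  exact ⟨_, hl, hr, hs, hd, hlt', by omega⟩

theorem Neighbors.exists_copyRectangle_eq (h : Neighbors p' q' p q ε) :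
    ∃ W H : ℤ, copyRectangle p' q' p q = Set.Icc (0 : ℝ) W ×ˢ Set.Icc (0 : ℝ) H ∧
      2 * W < omega p' q' ∧ H ≤ omega p' q' ∧
      2 * H + 4 * W ≤ omega p q + omega p' q' := by
  have ht := h.two_mul_tune_left
  have hlt := h.lt
  have hw' := three_le_omega h.left
  obtain ⟨W, hW⟩ : ∃ W : ℤ, W = min (tune p' q' : ℤ) (omega p' q' - 2 * tune p' q') := ⟨_, rfl⟩
  have hwidth : width p' q' = W := by
    rw [hW, width]
    push_cast
    rfl
  obtain ⟨h0, h1, -⟩ := tune_spec h.left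
  by_cases hweak : (omega p q : ℤ) < 2 * omega p' q'
  · rw [if_pos hweak] at ht
    -- `W ≤ τ'` gives `2H + 4W = 2ω' + 2W ≤ 2ω' + (ω - ω')`.
    refine ⟨W, omega p' q' - W, ?_, by omega, by omega, by omega⟩
    rw [copyRectangle, if_pos (by exact_mod_cast hweak), rectangle, hwidth]
    have hW0 : (0 : ℝ) ≤ W := by exact_mod_cast (by omega : 0 ≤ W)
    ext ⟨x, y⟩
    simp only [Set.mem_ofPred_eq, Set.mem_prod, Set.mem_Icc]
    push_cast
    constructor
    · rintro ⟨⟨hx, hy0, -⟩, hy⟩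
      exact ⟨hx, hy0, hy⟩
    · rintro ⟨hx, hy0, hy⟩
      exact ⟨⟨hx, hy0, by linarith⟩, hy⟩
  · rw [if_neg hweak] at ht
    -- Adding `2W ≤ 2τ' = 3ω' - ω` and `2W ≤ 2(ω' - 2τ') = 2ω - 4ω'` gives `4W ≤ ω - ω'`.
    refine ⟨W, omega p' q', ?_, by omega, le_rfl, by omega⟩
    rw [copyRectangle, if_neg (by exact_mod_cast hweak), rectangle, hwidth]
    push_cast
    rfl

end Plaid
end

theorem mainTheorem5 (p q p' q' : ℕ)
    (hpred : Plaid.IsEvenPredecessor p' q' p q) (hκ : Plaid.kappa p q = 0) :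
    Plaid.copyRectangle p' q' p q ∩ Plaid.plaid p' q' =
      Plaid.copyRectangle p' q' p q ∩ Plaid.plaid p q := by
  obtain ⟨ε, h⟩ := hpred.neighbors hκ
  obtain ⟨W, H, hR, hW, hH, hHW⟩ := h.exists_copyRectangle_eq
  rw [hR]
  apply Set.Subset.antisymm
  · refine Set.subset_inter Set.inter_subset_left (Plaid.rectangle_inter_plaid_subset ?_ ?_)
    · exact fun i l h0 h1 h2 h3 => (h.isGood_horizontal_iff hW hH hHW h0 h1 h2 h3).1
    · exact fun k j h0 h1 h2 h3 => (h.isGood_vertical_iff hW hH hHW h0 h1 h2 h3).1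
  · refine Set.subset_inter Set.inter_subset_left (Plaid.rectangle_inter_plaid_subset ?_ ?_)
    · exact fun i l h0 h1 h2 h3 => (h.isGood_horizontal_iff hW hH hHW h0 h1 h2 h3).2
    · exact fun k j h0 h1 h2 h3 => (h.isGood_vertical_iff hW hH hHW h0 h1 h2 h3).2
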